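/- For real numbers $t>0$ and $\alpha>0$ let $S_t(\alpha)=(s_1,s_2,\ldots)$ be the sequence with $s_n=\lfloor t\alpha^n\rfloor$. Call $S_t(\alpha)$ complete if all but finitely many positive integers can be written as a sum of finitely many terms of the sequence with pairwise distinct indices. Then the following hold. 1. If $1.3<\alpha\le1.4$, then $S_t(\alpha)$ is complete for all $0<t\le3$. 2. If $1.2<\alpha\le1.3$, then $S_t(\alpha)$ is complete for all $0<t\le5$. 3. If $1.1<\alpha\le1.2$, then $S_t(\alpha)$ is complete for all $0<t\le10$. 4. If $1<\alpha\le1.1$, then $S_t(\alpha)$ is complete for all $0<t\le50$. -/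

import Mathlib

/-- The sequence `S_t(α) = (s₁, s₂, …)` with `s_n = ⌊t α ^ n⌋`, indexed by the positive integers. -/
noncomputable def floorSeq (t α : ℝ) (n : ℕ+) : ℕ :=
  ⌊t * α ^ (n : ℕ)⌋₊

/-- `P(S)`: the numbers that are sums of finitely many distinct terms of the sequence `s`.
Terms are distinguished by their index, so a value that occurs `k` times in the sequence may be
used up to `k` times. The empty sum `0` is included. -/
def sumSet {ι : Type*} (s : ι → ℕ) : Set ℕ :=
  {m | ∃ A : Finset ι, ∑ n ∈ A, s n = m}

/-- A sequence is complete if all but finitely many natural numbers are sums of distinct terms. -/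
def IsCompleteSeq {ι : Type*} (s : ι → ℕ) : Prop :=
  (Set.univ \ sumSet s).Finite

/-!
Call `L` consecutive numbers that are sums of terms with distinct indices a run of length `L`. Once
a run of sums of terms with indices below `n` is at least as long as the `n`-th term, this term
prolongs the run by its own size, and since no term exceeds twice its predecessor (here `α ≤ 1.4`),
the same happens with all the later terms: the sequence is complete
(`isCompleteSeq_of_hasRun_of_le`).

For `α ≤ 1.1` a much shorter run suffices. Consider the `2 j` terms from the `n`-th on, with
`α ^ j ≈ 1.1 ^ 5`, and the sums of `j` of them. One gets from the `j` lowest indices to the `j`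
highest ones by moving one index up by one at a time, and the sum never increases by more than a gap
between neighbouring terms, which is at most `2.6 (α - 1)` times the `n`-th term (before rounding).
So a run of this length can be translated by these sums without leaving a gap, and the run that
arises is longer than the next term (`HasRun.slide`, `isCompleteSeq_of_hasRun_of_gap_le`). If `α` is
at most about `1.007`, these gaps are at most `1`, and the empty sum alone is a sufficient run.

It remains to find a first run. Given `t ≤ T ≤ Y`, some `y = t α ^ k` with `k ≥ 1` lies in
`(Y, Y α]`, and the terms before and after it are the integer parts of `y α ^ i`, `i ∈ ℤ`, as long
as `y α ^ i > T`. So only a compact set of pairs `(y, α)` matters. It is divided into boxes. On a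
small box most of the integer parts are constant; they yield a set of subset sums, stored as the
bits of a natural number, in which a run is looked for. Integer parts that are not constant on a box
are left out, or both values are tried. The function `searchBox` carries this out in integer
arithmetic, `isCompleteSeq_of_searchBox` proves it correct, and the kernel evaluates it.
-/

namespace FloorSeq

open Finset

/-! ### Runs of consecutive subset sums -/

/-- The `n`-th term `⌊t α ^ n⌋` with a natural number as index; only the indices `n ≥ 1` belong
to the sequence. -/
noncomputable def term (t α : ℝ) (n : ℕ) : ℕ := ⌊t * α ^ n⌋₊

/-- Some `L` consecutive numbers are sums of terms with distinct indices in `A`. -/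
def HasRun (f : ℕ → ℕ) (A : Finset ℕ) (L : ℕ) : Prop :=
  ∃ x, ∀ i < L, ∃ B ⊆ A, ∑ n ∈ B, f n = x + i

theorem isCompleteSeq_of_forall_ge {t α : ℝ} (x : ℕ)
    (h : ∀ y ≥ x, ∃ B : Finset ℕ, (∀ n ∈ B, 1 ≤ n) ∧ ∑ n ∈ B, term t α n = y) :
    IsCompleteSeq (floorSeq t α) := by
  refine (Set.finite_Iio x).subset ?_
  rintro y ⟨-, hy⟩
  by_contra hxy
  obtain ⟨B, hB, hsum⟩ := h y (not_lt.1 hxy)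
  refine hy ⟨B.preimage _ PNat.coe_injective.injOn, ?_⟩
  rw [← hsum]
  refine Finset.sum_preimage _ B PNat.coe_injective.injOn (term t α) ?_
  intro n hn hn'
  exact absurd ⟨⟨n, hB n hn⟩, rfl⟩ hn'

/-- If the run is at least as long as the next unused term, that term prolongs the run by its own
size; as no term is more than twice its predecessor, this repeats forever. -/
theorem isCompleteSeq_of_hasRun {t α : ℝ} {n L : ℕ} {A : Finset ℕ} (hA : A ⊆ Ico 1 n) (hn : 1 ≤ n)
    (hrun : HasRun (term t α) A L) (hL : term t α n ≤ L) (hpos : ∀ m ≥ n, 1 ≤ term t α m)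
    (hdouble : ∀ m ≥ n, term t α (m + 1) ≤ 2 * term t α m) :
    IsCompleteSeq (floorSeq t α) := by
  obtain ⟨x, hx⟩ := hrun
  have key : ∀ k, term t α (n + k) ≤ L + ∑ i ∈ range k, term t α (n + i) ∧
      ∀ i < L + ∑ i ∈ range k, term t α (n + i),
        ∃ B ⊆ Ico 1 (n + k), ∑ n ∈ B, term t α n = x + i := by
    intro k
    induction k with
    | zero =>
      refine ⟨by simpa using hL, fun i hi => ?_⟩
      obtain ⟨B, hB, hs⟩ := hx i (by simpa using hi)
      exact ⟨B, hB.trans hA, hs⟩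
    | succ k ih =>
      obtain ⟨h1, h2⟩ := ih
      have hd := hdouble (n + k) (by omega)
      rw [sum_range_succ]
      refine ⟨by rw [← add_assoc]; omega, fun i hi => ?_⟩
      by_cases hik : i < L + ∑ i ∈ range k, term t α (n + i)
      · obtain ⟨B, hB, hs⟩ := h2 i hik
        exact ⟨B, hB.trans (Ico_subset_Ico_right (by omega)), hs⟩
      · obtain ⟨B, hB, hs⟩ := h2 (i - term t α (n + k)) (by omega)
        have hnB : n + k ∉ B := fun h => by simpa using hB h
        refine ⟨insert (n + k) B, ?_, ?_⟩
        · refine insert_subset (by simp; omega) (hB.trans (Ico_subset_Ico_right (by omega)))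
        · rw [sum_insert hnB, hs]; omega
  refine isCompleteSeq_of_forall_ge x fun y hy => ?_
  have hlarge : y - x < L + ∑ i ∈ range (y + 1), term t α (n + i) := by
    have : ∑ i ∈ range (y + 1), 1 ≤ ∑ i ∈ range (y + 1), term t α (n + i) :=
      sum_le_sum fun i _ => hpos _ (by omega)
    simp at this
    omega
  obtain ⟨B, hB, hs⟩ := (key (y + 1)).2 _ hlarge
  exact ⟨B, fun m hm => (mem_Ico.1 (hB hm)).1, by omega⟩

theorem term_pos {t α : ℝ} {n : ℕ} (h : 1 ≤ t * α ^ n) : 1 ≤ term t α n :=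
  Nat.le_floor (by exact_mod_cast h)

theorem term_succ_le_two_mul {t α : ℝ} {n : ℕ} (hα : α ≤ 1.4) (h : 1 ≤ t * α ^ n) :
    term t α (n + 1) ≤ 2 * term t α n := by
  have h1 := term_pos h
  have h2 : t * α ^ n < term t α n + 1 := Nat.lt_floor_add_one _
  have h1' : (1 : ℝ) ≤ term t α n := by exact_mod_cast h1
  rw [← Nat.lt_add_one_iff]
  refine (Nat.floor_lt' (by omega)).2 ?_
  push_cast
  rw [pow_succ, ← mul_assoc]
  nlinarith

theorem isCompleteSeq_of_hasRun_of_le {t α : ℝ} {n L : ℕ} {A : Finset ℕ} (hA : A ⊆ Ico 1 n)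
    (hn : 1 ≤ n) (hα1 : 1 < α) (hα : α ≤ 1.4) (hx : 1 ≤ t * α ^ n)
    (hrun : HasRun (term t α) A L) (hL : term t α n ≤ L) :
    IsCompleteSeq (floorSeq t α) := by
  have hmono : ∀ m ≥ n, 1 ≤ t * α ^ m := by
    intro m hm
    obtain ⟨k, rfl⟩ := Nat.exists_eq_add_of_le hm
    rw [pow_add, ← mul_assoc]
    exact one_le_mul_of_one_le_of_one_le hx (one_le_pow₀ hα1.le)
  exact isCompleteSeq_of_hasRun hA hn hrun hL (fun m hm => term_pos (hmono m hm))
    fun m hm => term_succ_le_two_mul hα (hmono m hm)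

/-! ### Prolonging a run by sliding a block of indices -/

/-- Among the sums of `j` terms with indices in a window of length `2 * j`, one can pass from the
lowest `j` indices to the highest `j` indices by moving one index up by one at each step. If no
step increases the sum by more than `L`, then translates of a run of length `L` by these sums
leave no gap. -/
theorem HasRun.slide {f : ℕ → ℕ} {A : Finset ℕ} {L n j : ℕ} (hrun : HasRun f A L)
    (hA : ∀ i ∈ A, i < n) (hstep : ∀ i, n ≤ i → i + 1 < n + 2 * j → f (i + 1) ≤ f i + L) :
    HasRun f (A ∪ Ico n (n + 2 * j))
      (∑ i ∈ Ico (n + j) (n + 2 * j), f i - ∑ i ∈ Ico n (n + j), f i + L) := by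
  obtain ⟨x, hx⟩ := hrun
  set W := Ico n (n + 2 * j) with hW
  -- `Cov C`: every number from the initial position up to the end of the run translated by the
  -- sum over `C` is attained.
  let Cov : Finset ℕ → Prop := fun C => ∀ y, x + ∑ i ∈ Ico n (n + j), f i ≤ y →
    y < x + ∑ i ∈ C, f i + L → ∃ B ⊆ A ∪ W, ∑ n ∈ B, f n = y
  have translate : ∀ C ⊆ W, ∀ i < L, ∃ B ⊆ A ∪ W, ∑ n ∈ B, f n = x + ∑ n ∈ C, f n + i := by
    intro C hC i hi
    obtain ⟨B, hB, hs⟩ := hx i hi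
    refine ⟨B ∪ C, union_subset_union hB hC, ?_⟩
    rw [sum_union, hs]
    · omega
    · refine disjoint_left.2 fun k hk hk' => ?_
      have := hA k (hB hk)
      have := mem_Ico.1 (hC hk')
      omega
  have step : ∀ C i, i ∉ C → i + 1 ∉ C → insert (i + 1) C ⊆ W → n ≤ i → Cov (insert i C) →
      Cov (insert (i + 1) C) := by
    intro C i hi hi' hC hni hcov y hy hy'
    by_cases h : y < x + ∑ k ∈ insert i C, f k + L
    · exact hcov y hy h
    · rw [sum_insert hi] at h
      have hlt : i + 1 < n + 2 * j := (mem_Ico.1 (hC (mem_insert_self _ _))).2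
      have hst := hstep i hni hlt
      have hle : x + ∑ k ∈ insert (i + 1) C, f k ≤ y := by rw [sum_insert hi']; omega
      obtain ⟨B, hB, hs⟩ := translate _ hC (y - (x + ∑ k ∈ insert (i + 1) C, f k)) (by omega)
      exact ⟨B, hB, by omega⟩
  have move : ∀ C i, n ≤ i → C ⊆ W → ∀ r, (∀ s ≤ r, i + s ∉ C) → i + r < n + 2 * j →
      Cov (insert i C) → Cov (insert (i + r) C) := by
    intro C i hni hC r
    induction r with
    | zero => intro _ _ h; exact h
    | succ r ih =>
      intro hnot hlt h
      refine step C (i + r) (hnot r (by omega)) (hnot (r + 1) le_rfl) ?_ (by omega)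
        (ih (fun s hs => hnot s (by omega)) (by omega) h)
      exact insert_subset (mem_Ico.2 ⟨by omega, by omega⟩) hC
  have all : ∀ q ≤ j, Cov (Ico n (n + j - q) ∪ Ico (n + 2 * j - q) (n + 2 * j)) := by
    intro q
    induction q with
    | zero =>
      intro _ y hy hy'
      rw [tsub_zero, tsub_zero, Ico_self, union_empty] at hy'
      have hsub : Ico n (n + j) ⊆ W := Ico_subset_Ico_right (by omega)
      obtain ⟨B, hB, hs⟩ := translate _ hsub (y - (x + ∑ i ∈ Ico n (n + j), f i)) (by omega)
      exact ⟨B, hB, by omega⟩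
    | succ q ih =>
      intro hq
      have h1 : Ico n (n + j - q) ∪ Ico (n + 2 * j - q) (n + 2 * j) =
          insert (n + j - (q + 1))
            (Ico n (n + j - (q + 1)) ∪ Ico (n + 2 * j - q) (n + 2 * j)) := by
        ext i; simp only [mem_union, mem_Ico, mem_insert]; omega
      have h2 : Ico n (n + j - (q + 1)) ∪ Ico (n + 2 * j - (q + 1)) (n + 2 * j) =
          insert (n + j - (q + 1) + j)
            (Ico n (n + j - (q + 1)) ∪ Ico (n + 2 * j - q) (n + 2 * j)) := by
        ext i; simp only [mem_union, mem_Ico, mem_insert]; omega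
      rw [h2]
      refine move _ _ (by omega) ?_ j ?_ (by omega) (h1 ▸ ih (by omega))
      · intro i; simp only [mem_union, mem_Ico, hW]; omega
      · intro s hs; simp only [mem_union, mem_Ico]; omega
  have hfin := all j le_rfl
  rw [Nat.add_sub_cancel, Ico_self, empty_union, show n + 2 * j - j = n + j by omega] at hfin
  by_cases hle : ∑ i ∈ Ico n (n + j), f i ≤ ∑ i ∈ Ico (n + j) (n + 2 * j), f i
  · refine ⟨x + ∑ i ∈ Ico n (n + j), f i, fun i hi => hfin _ (by omega) (by omega)⟩
  · refine ⟨x, fun i hi => ?_⟩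
    obtain ⟨B, hB, hs⟩ := hx i (by omega)
    exact ⟨B, hB.trans subset_union_left, hs⟩

/-- For `α ≤ 1.1` a run need only be a little longer than the gaps between consecutive terms.
The window of the `2 * j` terms from index `n` on is used, where `α ^ j ≈ 1.1 ^ 5`. -/
theorem isCompleteSeq_of_hasRun_of_gap_le {t α : ℝ} {n L : ℕ} {A : Finset ℕ} (hA : A ⊆ Ico 1 n)
    (hn : 1 ≤ n) (hα1 : 1 < α) (hα : α ≤ 1.1) (hx : 50 ≤ t * α ^ n)
    (hrun : HasRun (term t α) A L) (hL : 13 * (α - 1) * (t * α ^ n) ≤ 5 * L) :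
    IsCompleteSeq (floorSeq t α) := by
  obtain ⟨j, hj1, hj2⟩ := exists_nat_pow_near (x := (1.61051 : ℝ)) (by norm_num) hα1
  set x := t * α ^ n with hxdef
  set β := α ^ j with hβ
  have hterm : ∀ i, t * α ^ (n + i) = x * α ^ i := fun i => by rw [pow_add, hxdef, mul_assoc]
  have hβ1 : 1.4641 ≤ β := by
    rw [pow_succ] at hj2
    nlinarith
  have hpow2 : α ^ (2 * j) = β ^ 2 := by rw [hβ, ← pow_mul, mul_comm]
  have hstep : ∀ i, n ≤ i → i + 1 < n + 2 * j → term t α (i + 1) ≤ term t α i + L := by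
    intro i hi hij
    obtain ⟨r, rfl⟩ := Nat.exists_eq_add_of_le hi
    have hr : α ^ r ≤ β ^ 2 := hpow2 ▸ pow_le_pow_right₀ hα1.le (by omega)
    -- The constant `13 / 5` in the hypothesis on `L` exceeds `1.1 ^ 10`.
    have hr' : α ^ r ≤ 2.6 := hr.trans (by nlinarith)
    unfold term
    rw [← Nat.floor_add_natCast (by rw [hterm]; positivity)]
    refine Nat.floor_le_floor ?_
    rw [add_assoc, hterm, hterm, pow_succ]
    have : (α - 1) * x * α ^ r ≤ (α - 1) * x * 2.6 :=
      mul_le_mul_of_nonneg_left hr' (mul_nonneg (by linarith) (by linarith))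
    nlinarith
  have hslide := hrun.slide (fun i hi => (mem_Ico.1 (hA hi)).2) hstep
  refine isCompleteSeq_of_hasRun_of_le (n := n + 2 * j) ?_ (by omega) hα1 (by linarith) ?_
    hslide ?_
  · refine union_subset (hA.trans (Ico_subset_Ico_right (by omega)))
      (Ico_subset_Ico_left hn)
  · rw [hterm]
    nlinarith [one_le_pow₀ hα1.le (n := 2 * j)]
  · have hgeom : ∑ i ∈ range j, α ^ i = (β - 1) / (α - 1) := geom_sum_eq hα1.ne' j
    have hbern : (j : ℝ) ≤ (β - 1) / (α - 1) := by
      rw [le_div_iff₀ (by linarith)]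
      have := one_add_mul_le_pow (a := α - 1) (by linarith) j
      rw [add_sub_cancel] at this
      linarith
    have hlow : ((∑ i ∈ Ico n (n + j), term t α i : ℕ) : ℝ) ≤ x * ((β - 1) / (α - 1)) := by
      rw [sum_Ico_eq_sum_range, Nat.add_sub_cancel_left, ← hgeom, mul_sum]
      push_cast
      refine sum_le_sum fun i _ => ?_
      rw [← hterm]
      exact Nat.floor_le (by rw [hterm]; positivity)
    have hhigh : β * x * ((β - 1) / (α - 1)) - j ≤
        ((∑ i ∈ Ico (n + j) (n + 2 * j), term t α i : ℕ) : ℝ) := by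
      rw [sum_Ico_eq_sum_range, show n + 2 * j - (n + j) = j by omega, ← hgeom, mul_sum]
      have : (j : ℝ) = ∑ i ∈ range j, (1 : ℝ) := by simp
      rw [this, ← sum_sub_distrib]
      push_cast
      refine sum_le_sum fun i _ => ?_
      have := Nat.lt_floor_add_one (t * α ^ (n + j + i))
      rw [add_assoc, hterm, pow_add] at this
      unfold term
      rw [add_assoc, hterm, pow_add, hβ]
      nlinarith
    -- The loss `j` by rounding is at most `γ ≤ 0.02 * x * γ`, because `50 ≤ x`.
    have hmain : x * β ^ 2 ≤
        (β * x * ((β - 1) / (α - 1)) - j) - x * ((β - 1) / (α - 1)) + L := by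
      set γ := (β - 1) / (α - 1) with hγ
      have hγ' : γ * (α - 1) = β - 1 := div_mul_cancel₀ _ (by linarith)
      have hγ0 : 0 ≤ γ := div_nonneg (by linarith) (by linarith)
      have h1 : x * β ^ 2 ≤ x * ((β - 1 - 0.02) * γ + 2.6 * (α - 1)) := by
        refine mul_le_mul_of_nonneg_left ?_ (by linarith)
        have h0 : 0 < α - 1 := by linarith
        refine le_of_mul_le_mul_right ?_ h0
        rw [show ((β - 1 - 0.02) * γ + 2.6 * (α - 1)) * (α - 1) =
          (β - 1 - 0.02) * (γ * (α - 1)) + 2.6 * (α - 1) ^ 2 by ring, hγ']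
        -- The difference of the two sides increases with `β` and decreases with `α`.
        have h2 : 0 ≤ (β - 1.4641) * ((β + 1.4641) * (1 - (α - 1)) - 2.02) :=
          mul_nonneg (by linarith) (by nlinarith)
        have h3 : 0 ≤ (0.1 - (α - 1)) * (1.8 - 2.6 * (α - 1)) :=
          mul_nonneg (by linarith) (by linarith)
        nlinarith
      nlinarith
    have hcast : (term t α (n + 2 * j) : ℝ) ≤ x * β ^ 2 := by
      rw [← hpow2, ← hterm]
      exact Nat.floor_le (by rw [hterm]; positivity)
    have : (term t α (n + 2 * j) + ∑ i ∈ Ico n (n + j), term t α i : ℕ) ≤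
        ∑ i ∈ Ico (n + j) (n + 2 * j), term t α i + L := by
      have : ((term t α (n + 2 * j) + ∑ i ∈ Ico n (n + j), term t α i : ℕ) : ℝ) ≤
        (∑ i ∈ Ico (n + j) (n + 2 * j), term t α i + L : ℕ) := by
        push_cast at hlow hhigh ⊢
        linarith
      exact_mod_cast this
    omega

/-! ### The search procedure

The functions use `bif` and the Boolean comparisons of `Nat`, as the kernel has to evaluate them.
-/

/-- The numbers `t α ^ n` are bounded in units of `1 / yScale`. -/
abbrev yScale : ℕ := 1048576

/-- The ratio `α` is bounded in units of `1 / αScale`; all the bounds on `α` that occur are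
multiples of the unit. -/
abbrev αScale : ℕ := 655360

/-- Whether `L` consecutive bits are set in a number. The bits of `R` mark the beginnings of the
blocks of `k` consecutive set bits; at each step `k` is doubled, or raised to `L`. Here and in the
functions below the first argument of the recursion bounds the number of steps, and the answer is
`false` when it is exhausted. -/
def hasBitRun : ℕ → ℕ → ℕ → ℕ → Bool
  | 0, _, _, _ => false
  | fuel + 1, R, k, L =>
    bif Nat.ble L k then Nat.ble 1 R
    else
      let s := bif Nat.ble (k + k) L then k else L - k
      let R' := R &&& (R >>> s)
      bif Nat.beq R' 0 then false else hasBitRun fuel R' (k + s) L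

/-- Goes up through the terms `x, x α, x α², …`, where `lo ≤ x ≤ hi` and `a ≤ α ≤ b` in the units
above, until the subset sums of the terms collected contain a run longer than `u / v` times the
next term. The bits of `P` are the subset sums collected so far. A term is used if its integer part
is determined by the bounds, or if it has two possible values and the budget `m` allows to treat
both. The search for runs begins when at most `g` terms remain. -/
def searchUp (u v a b g : ℕ) : ℕ → ℕ → ℕ → ℕ → ℕ → Bool
  | 0, _, _, _, _ => false
  | fuel + 1, lo, hi, P, m =>
    let l := lo / yScale
    let h := hi / yScale
    let lo' := lo * a / αScale
    let hi' := hi * b / αScale + 1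
    let use (w m' : ℕ) : Bool :=
      let P' := P ||| (P <<< w)
      Nat.ble fuel g && hasBitRun 14 P' 1 (u * hi' / v + 1) ||
        searchUp u v a b g fuel lo' hi' P' m'
    bif Nat.beq l h then use l m
    else bif Nat.ble 1 m && Nat.beq (l + 1) h then use l (m - 1) && use h (m - 1)
    else searchUp u v a b g fuel lo' hi' P m

/-- Goes down through the terms `x, x / α, x / α², …` as long as they certainly exceed `T`, then
goes up from a term with bounds `lo₀` and `hi₀`. -/
def searchDown (T u v a b g N lo₀ hi₀ : ℕ) : ℕ → ℕ → ℕ → ℕ → ℕ → Bool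
  | 0, _, _, _, _ => false
  | fuel + 1, lo, hi, P, m =>
    bif Nat.ble lo T then searchUp u v a b g N lo₀ hi₀ P m
    else
      let l := lo / yScale
      let h := hi / yScale
      let lo' := lo * αScale / b
      let hi' := hi * αScale / a + 1
      let use (w m' : ℕ) : Bool :=
        searchDown T u v a b g N lo₀ hi₀ fuel lo' hi' (P ||| (P <<< w)) m'
      bif Nat.beq l h then use l m
      else bif Nat.ble 1 m && Nat.beq (l + 1) h then use l (m - 1) && use h (m - 1)
      else searchDown T u v a b g N lo₀ hi₀ fuel lo' hi' P m

/-- Whether a run has to be compared with the next term itself (`term`), or with `2.6 * (α - 1)`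
times the next term (`gap`). -/
inductive Criterion
  | term
  | gap

/-- The numerator `u` of the factor `u / v` with which the next term, given in units of `1 / yScale`,
is multiplied; `b` is the upper bound for `α`, in units of `1 / αScale`. -/
def Criterion.num (b : ℕ) : Criterion → ℕ
  | term => 1
  | gap => 13 * (b - αScale)

/-- The denominator of the factor described at `Criterion.num`. -/
def Criterion.den : Criterion → ℕ
  | term => yScale
  | gap => 5 * αScale * yScale

/-- Searches the box `p ≤ y ≤ q`, `a ≤ α ≤ b` (in the units above) for points `(y, α)` with `y ≤ Y α`
at which no long run is found; the answer `true` means that there are none. Boxes with `b - a > w`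
are split without a trial. The side for `y` is halved if its relative length is at least `r` times
that of the side for `α`, otherwise the side for `α`. -/
def searchBox (c : Criterion) (T Y g N m r w : ℕ) : ℕ → ℕ → ℕ → ℕ → ℕ → Bool
  | 0, _, _, _, _ => false
  | fuel + 1, p, q, a, b =>
    Nat.blt (Y * b) (p * αScale) ||
    (Nat.ble (b - a) w && searchDown T (c.num b) c.den a b g N p q 60
      (p * αScale / b) (q * αScale / a + 1) 1 m) ||
    bif Nat.ble (r * (b - a) * p) ((q - p) * a) then
      let d := (p + q) / 2
      searchBox c T Y g N m r w fuel p d a b && searchBox c T Y g N m r w fuel d q a b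
    else
      let d := (a + b) / 2
      searchBox c T Y g N m r w fuel p q a d && searchBox c T Y g N m r w fuel p q d b

/-! ### Correctness of the search -/

theorem exists_run_of_hasBitRun {P : ℕ} : ∀ {fuel R k L : ℕ},
    (∀ x, R.testBit x → ∀ i < k, P.testBit (x + i)) → hasBitRun fuel R k L →
    ∃ x, ∀ i < L, P.testBit (x + i)
  | 0, _, _, _, _, h => by simp [hasBitRun] at h
  | fuel + 1, R, k, L, hR, h => by
    rw [hasBitRun] at h
    by_cases hLk : L ≤ k
    · rw [Nat.ble_eq_true_of_le hLk] at h
      have hne : R ≠ 0 := by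
        rintro rfl
        simp at h
      obtain ⟨x, hx⟩ := Nat.exists_testBit_of_ne_zero hne
      exact ⟨x, fun i hi => hR x hx i (hi.trans_le hLk)⟩
    · rw [show Nat.ble L k = false by rwa [← Bool.not_eq_true, Nat.ble_eq]] at h
      generalize hs : (bif Nat.ble (k + k) L then k else L - k) = s at h
      have hsk : s ≤ k := by
        rw [← hs]
        by_cases hk : k + k ≤ L
        · rw [Nat.ble_eq_true_of_le hk]; rfl
        · rw [show Nat.ble (k + k) L = false by rwa [← Bool.not_eq_true, Nat.ble_eq]]
          simp only [cond_false]; omega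
      rw [cond_false, Bool.cond_eq_ite] at h
      split_ifs at h
      refine exists_run_of_hasBitRun (fun x hx i hi => ?_) h
      simp only [Nat.testBit_land, Nat.testBit_shiftRight, Bool.and_eq_true] at hx
      by_cases hik : i < k
      · exact hR x hx.1 i hik
      · have := hR _ hx.2 (i - s) (by omega)
        rwa [show s + x + (i - s) = x + i by omega] at this

/-- All the set bits of `P` are sums of terms with distinct indices in `A`. -/
def Marks (f : ℕ → ℕ) (A : Finset ℕ) (P : ℕ) : Prop :=
  ∀ w, P.testBit w → ∃ B ⊆ A, ∑ n ∈ B, f n = w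

theorem marks_one (f : ℕ → ℕ) : Marks f ∅ 1 := by
  intro w hw
  rw [Nat.testBit_one_eq_true_iff_self_eq_zero] at hw
  exact ⟨∅, subset_rfl, by simp [hw]⟩

theorem Marks.mono {f : ℕ → ℕ} {A A' : Finset ℕ} {P : ℕ} (h : Marks f A P) (hA : A ⊆ A') :
    Marks f A' P := fun w hw =>
  let ⟨B, hB, hs⟩ := h w hw
  ⟨B, hB.trans hA, hs⟩

theorem Marks.insert {f : ℕ → ℕ} {A : Finset ℕ} {P n w : ℕ} (h : Marks f A P) (hn : n ∉ A)
    (hw : f n = w) : Marks f (insert n A) (P ||| (P <<< w)) := by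
  intro v hv
  simp only [Nat.testBit_lor, Nat.testBit_shiftLeft, Bool.or_eq_true, Bool.and_eq_true,
    decide_eq_true_eq] at hv
  rcases hv with hv | ⟨hwv, hv⟩
  · obtain ⟨B, hB, hs⟩ := h v hv
    exact ⟨B, hB.trans (subset_insert _ _), hs⟩
  · obtain ⟨B, hB, hs⟩ := h _ hv
    refine ⟨Insert.insert n B, insert_subset_insert _ hB, ?_⟩
    rw [sum_insert fun hnB => hn (hB hnB), hs, hw]
    omega

theorem Marks.hasRun {f : ℕ → ℕ} {A : Finset ℕ} {P fuel L : ℕ} (h : Marks f A P)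
    (hP : hasBitRun fuel P 1 L) : HasRun f A L := by
  obtain ⟨x, hx⟩ := exists_run_of_hasBitRun (P := P) (by simp +contextual) hP
  exact ⟨x, fun i hi => h _ (hx i hi)⟩

theorem div_le_floor {x : ℝ} {lo : ℕ} (h : lo ≤ x * yScale) : lo / yScale ≤ ⌊x⌋₊ := by
  refine Nat.le_floor (Nat.cast_div_le.trans ?_)
  rwa [div_le_iff₀ (by norm_num)]

theorem floor_le_div {x : ℝ} {hi : ℕ} (h : x * yScale ≤ hi) : ⌊x⌋₊ ≤ hi / yScale := by
  rw [Nat.le_div_iff_mul_le (by norm_num)]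
  rcases Nat.eq_zero_or_pos ⌊x⌋₊ with h0 | h0
  · simp [h0]
  · have : ((⌊x⌋₊ * yScale : ℕ) : ℝ) ≤ hi := by
      push_cast at h ⊢
      have := Nat.floor_le ((Nat.floor_pos.1 h0).trans' zero_le_one)
      nlinarith
    exact_mod_cast this

theorem le_mul_of_bounds {x α : ℝ} {lo a : ℕ} (hlo : lo ≤ x * yScale) (ha : a ≤ α * αScale) :
    ((lo * a / αScale : ℕ) : ℝ) ≤ x * α * yScale := by
  refine Nat.cast_div_le.trans ?_
  rw [div_le_iff₀ (by norm_num)]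
  push_cast at *
  calc (lo : ℝ) * a ≤ (x * 1048576) * (α * 655360) :=
        mul_le_mul hlo ha (by positivity) (by linarith [Nat.cast_nonneg (α := ℝ) lo])
    _ = _ := by ring

theorem mul_le_of_bounds {x α : ℝ} {hi b : ℕ} (hα : 0 ≤ α) (hhi : x * yScale ≤ hi)
    (hb : α * αScale ≤ b) : x * α * yScale ≤ ((hi * b / αScale + 1 : ℕ) : ℝ) := by
  have h1 : x * α * yScale * αScale ≤ (hi * b : ℕ) := by
    push_cast at *
    calc x * α * 1048576 * 655360 = (x * 1048576) * (α * 655360) := by ring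
      _ ≤ _ := by gcongr
  have h2 : ((hi * b : ℕ) : ℝ) < ((αScale * (hi * b / αScale + 1) : ℕ) : ℝ) := by
    exact_mod_cast Nat.lt_mul_div_succ _ (by norm_num)
  push_cast at *
  linarith

theorem le_div_of_bounds {x α : ℝ} {lo b : ℕ} (hα : 0 < α) (hx : 0 ≤ x) (hlo : lo ≤ x * α * yScale)
    (hb : α * αScale ≤ b) : ((lo * αScale / b : ℕ) : ℝ) ≤ x * yScale := by
  refine Nat.cast_div_le.trans ?_
  push_cast at *
  have hb0 : (0 : ℝ) < b := by linarith
  rw [div_le_iff₀ hb0]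
  calc (lo : ℝ) * 655360 ≤ (x * α * 1048576) * 655360 := by gcongr
    _ = x * 1048576 * (α * 655360) := by ring
    _ ≤ _ := by gcongr

theorem div_le_of_bounds {x α : ℝ} {hi a : ℕ} (hx : 0 ≤ x) (ha0 : 0 < a)
    (hhi : x * α * yScale ≤ hi) (ha : a ≤ α * αScale) :
    x * yScale ≤ ((hi * αScale / a + 1 : ℕ) : ℝ) := by
  have h1 : x * yScale * a ≤ (hi * αScale : ℕ) := by
    push_cast at *
    calc x * 1048576 * a ≤ x * 1048576 * (α * 655360) := by gcongr
      _ = x * α * 1048576 * 655360 := by ring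
      _ ≤ _ := by gcongr
  have h2 : ((hi * αScale : ℕ) : ℝ) < ((a * (hi * αScale / a + 1) : ℕ) : ℝ) := by
    exact_mod_cast Nat.lt_mul_div_succ _ ha0
  push_cast at *
  have ha0' : (0 : ℝ) < a := by exact_mod_cast ha0
  nlinarith

theorem floor_eq_or {x : ℝ} {lo hi : ℕ} (hlo : lo ≤ x * yScale) (hhi : x * yScale ≤ hi)
    (h : lo / yScale + 1 = hi / yScale) : ⌊x⌋₊ = lo / yScale ∨ ⌊x⌋₊ = hi / yScale := by
  have h1 := div_le_floor hlo
  have h2 := floor_le_div hhi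
  omega

section

variable {t α : ℝ} {u v a b g k : ℕ}

theorem isCompleteSeq_of_searchUp (hk : 1 ≤ k) (hα : 0 < α) (ha : a ≤ α * αScale)
    (hb : α * αScale ≤ b) (hv : 0 < v)
    (hfin : ∀ n ≥ k, ∀ A ⊆ Ico 1 n, ∀ L : ℕ, HasRun (term t α) A L →
      u * (t * α ^ n * yScale) ≤ v * L → IsCompleteSeq (floorSeq t α)) :
    ∀ {fuel lo hi P m n : ℕ} {A : Finset ℕ}, k ≤ n → A ⊆ Ico 1 n →
      lo ≤ t * α ^ n * yScale → t * α ^ n * yScale ≤ hi → Marks (term t α) A P →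
      searchUp u v a b g fuel lo hi P m → IsCompleteSeq (floorSeq t α)
  | 0, _, _, _, _, _, _, _, _, _, _, _, h => by simp [searchUp] at h
  | fuel + 1, lo, hi, P, m, n, A, hn, hA, hlo, hhi, hP, h => by
    have hlo' : ((lo * a / αScale : ℕ) : ℝ) ≤ t * α ^ (n + 1) * yScale := by
      rw [pow_succ, ← mul_assoc]; exact le_mul_of_bounds hlo ha
    have hhi' : t * α ^ (n + 1) * yScale ≤ ((hi * b / αScale + 1 : ℕ) : ℝ) := by
      rw [pow_succ, ← mul_assoc]; exact mul_le_of_bounds hα.le hhi hb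
    have hsub : A ⊆ Ico 1 (n + 1) := hA.trans (Ico_subset_Ico_right (by omega))
    have use : ∀ w m', term t α n = w →
        (Nat.ble fuel g && hasBitRun 14 (P ||| (P <<< w)) 1 (u * (hi * b / αScale + 1) / v + 1) ||
        searchUp u v a b g fuel (lo * a / αScale) (hi * b / αScale + 1) (P ||| (P <<< w)) m') →
        IsCompleteSeq (floorSeq t α) := by
      intro w m' hw h
      have hnA : n ∉ A := fun h => by simpa using hA h
      have hsub' : insert n A ⊆ Ico 1 (n + 1) := insert_subset (by simp; omega) hsub
      have hP' := hP.insert hnA hw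
      rw [Bool.or_eq_true, Bool.and_eq_true] at h
      rcases h with ⟨-, h⟩ | h
      · refine hfin (n + 1) (by omega) _ hsub' _ (hP'.hasRun h) ?_
        calc (u : ℝ) * (t * α ^ (n + 1) * yScale)
            ≤ u * ((hi * b / αScale + 1 : ℕ) : ℝ) := by gcongr
          _ ≤ _ := by exact_mod_cast (Nat.lt_mul_div_succ _ hv).le
      · exact isCompleteSeq_of_searchUp hk hα ha hb hv hfin (by omega) hsub' hlo' hhi' hP' h
    simp only [searchUp, Bool.cond_eq_ite, Bool.and_eq_true (Nat.ble _ _), Nat.beq_eq] at h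
    split_ifs at h with h1 h2
    · refine use _ _ ?_ h
      have := div_le_floor hlo
      have := floor_le_div hhi
      unfold term
      omega
    · rcases floor_eq_or hlo hhi h2.2 with hw | hw
      · exact use _ _ hw (Bool.and_eq_true _ _ ▸ h).1
      · exact use _ _ hw (Bool.and_eq_true _ _ ▸ h).2
    · exact isCompleteSeq_of_searchUp hk hα ha hb hv hfin (by omega) hsub hlo' hhi' hP h

theorem isCompleteSeq_of_searchDown {T N lo₀ hi₀ : ℕ} (ht : 0 < t) (hα : 0 < α) (ha0 : 0 < a)
    (ha : a ≤ α * αScale) (hb : α * αScale ≤ b) (hv : 0 < v)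
    (hfin : ∀ n ≥ k, ∀ A ⊆ Ico 1 n, ∀ L : ℕ, HasRun (term t α) A L →
      u * (t * α ^ n * yScale) ≤ v * L → IsCompleteSeq (floorSeq t α))
    (hT : t * yScale ≤ T) (hk : 1 ≤ k) (hlo₀ : lo₀ ≤ t * α ^ k * yScale)
    (hhi₀ : t * α ^ k * yScale ≤ hi₀) :
    ∀ {fuel lo hi P m n : ℕ} {A : Finset ℕ}, A ⊆ Ico (n + 1) k → n < k →
      lo ≤ t * α ^ n * yScale → t * α ^ n * yScale ≤ hi → Marks (term t α) A P →
      searchDown T u v a b g N lo₀ hi₀ fuel lo hi P m → IsCompleteSeq (floorSeq t α)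
  | 0, _, _, _, _, _, _, _, _, _, _, _, h => by simp [searchDown] at h
  | fuel + 1, lo, hi, P, m, n, A, hA, hnk, hlo, hhi, hP, h => by
    by_cases hloT : lo ≤ T
    · simp only [searchDown, Nat.ble_eq_true_of_le hloT, cond_true] at h
      exact isCompleteSeq_of_searchUp hk hα ha hb hv hfin le_rfl
        (hA.trans (Ico_subset_Ico_left (by omega))) hlo₀ hhi₀ hP h
    rw [searchDown, show Nat.ble lo T = false by rwa [← Bool.not_eq_true, Nat.ble_eq]] at h
    -- A term above `T` is not `t α ^ 0`, so it belongs to the sequence and has a predecessor.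
    obtain _ | n := n
    · have : (T : ℝ) < lo := by exact_mod_cast not_le.1 hloT
      rw [pow_zero, mul_one] at hlo
      linarith
    have hx : 0 ≤ t * α ^ n := by positivity
    rw [pow_succ, ← mul_assoc] at hlo hhi
    have hlo' := le_div_of_bounds hα hx hlo hb
    have hhi' := div_le_of_bounds hx ha0 hhi ha
    have hsub : A ⊆ Ico (n + 1) k := hA.trans (Ico_subset_Ico_left (by omega))
    have use : ∀ w m', term t α (n + 1) = w →
        searchDown T u v a b g N lo₀ hi₀ fuel (lo * αScale / b) (hi * αScale / a + 1)
          (P ||| (P <<< w)) m' →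
        IsCompleteSeq (floorSeq t α) := by
      intro w m' hw h
      have hnA : n + 1 ∉ A := fun h => by simpa using hA h
      exact isCompleteSeq_of_searchDown ht hα ha0 ha hb hv hfin hT hk hlo₀ hhi₀
        (insert_subset (by simp; omega) hsub) (by omega) hlo' hhi' (hP.insert hnA hw) h
    have hfl : term t α (n + 1) = ⌊t * α ^ n * α⌋₊ := by rw [term, pow_succ, mul_assoc]
    simp only [Bool.cond_eq_ite, Bool.and_eq_true (Nat.ble _ _), Nat.beq_eq, Bool.false_eq_true,
      if_false] at h
    split_ifs at h with h1 h2
    · refine use _ _ ?_ h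
      have := div_le_floor hlo
      have := floor_le_div hhi
      omega
    · rcases floor_eq_or hlo hhi h2.2 with hw | hw
      · exact use _ _ (hfl.trans hw) (Bool.and_eq_true _ _ ▸ h).1
      · exact use _ _ (hfl.trans hw) (Bool.and_eq_true _ _ ▸ h).2
    · exact isCompleteSeq_of_searchDown ht hα ha0 ha hb hv hfin hT hk hlo₀ hhi₀ hsub (by omega)
        hlo' hhi' hP h

end

/-- The range of parameters in which a criterion is sufficient for completeness, provided that the
next term is at least `Y`. -/
def Criterion.Valid (α : ℝ) (Y : ℕ) : Criterion → Prop
  | term => α ≤ 1.4 ∧ yScale ≤ Y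
  | gap => α ≤ 1.1 ∧ 50 * yScale ≤ Y

theorem Criterion.den_pos (c : Criterion) : 0 < c.den := by
  cases c <;> norm_num [den]

theorem Criterion.Valid.isCompleteSeq {c : Criterion} {t α : ℝ} {Y b n L : ℕ} {A : Finset ℕ}
    (hc : c.Valid α Y) (hα1 : 1 < α) (hb : α * αScale ≤ b) (hY : Y ≤ t * α ^ n * yScale)
    (hn : 1 ≤ n) (hA : A ⊆ Ico 1 n) (hrun : HasRun (FloorSeq.term t α) A L)
    (h : c.num b * (t * α ^ n * yScale) ≤ c.den * L) : IsCompleteSeq (floorSeq t α) := by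
  cases c with
  | term =>
    have hα : α ≤ 1.4 := hc.1
    have hY'' : ((yScale : ℕ) : ℝ) ≤ Y := Nat.cast_le.2 hc.2
    clear hc
    replace h : ((1 : ℕ) : ℝ) * (t * α ^ n * yScale) ≤ (yScale : ℕ) * L := h
    push_cast at h hY hY''
    have hle : t * α ^ n ≤ L := by linarith
    refine isCompleteSeq_of_hasRun_of_le hA hn hα1 hα (by linarith) hrun ?_
    have : (FloorSeq.term t α n : ℝ) ≤ L := (Nat.floor_le (by linarith)).trans hle
    exact_mod_cast this
  | gap =>
    have hα : α ≤ 1.1 := hc.1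
    have hY'' : ((50 * yScale : ℕ) : ℝ) ≤ Y := Nat.cast_le.2 hc.2
    clear hc
    have hDb : αScale ≤ b := by
      have : ((αScale : ℕ) : ℝ) ≤ b := by push_cast at hb ⊢; linarith
      exact Nat.cast_le.1 this
    replace h : ((13 * (b - αScale) : ℕ) : ℝ) * (t * α ^ n * yScale) ≤
        (5 * αScale * yScale : ℕ) * L := h
    push_cast [Nat.cast_sub hDb] at h hY hY'' hb
    have hx : 50 ≤ t * α ^ n := by linarith
    refine isCompleteSeq_of_hasRun_of_gap_le hA hn hα1 hα hx hrun ?_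
    have : (α - 1) * 655360 * (t * α ^ n) ≤ (b - 655360) * (t * α ^ n) :=
      mul_le_mul_of_nonneg_right (by linarith) (by linarith)
    linarith

theorem isCompleteSeq_of_searchBox {c : Criterion} {t α : ℝ} {T Y g N m r w k : ℕ} (ht : 0 < t)
    (hα1 : 1 < α) (hc : c.Valid α Y) (hT : t * yScale ≤ T) (hk : 1 ≤ k)
    (hY : Y ≤ t * α ^ k * yScale) (hY' : t * α ^ k * yScale ≤ Y * α) :
    ∀ {fuel p q a b : ℕ}, 0 < a → p ≤ t * α ^ k * yScale → t * α ^ k * yScale ≤ q →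
      a ≤ α * αScale → α * αScale ≤ b → searchBox c T Y g N m r w fuel p q a b →
      IsCompleteSeq (floorSeq t α)
  | 0, _, _, _, _, _, _, _, _, _, h => by simp [searchBox] at h
  | fuel + 1, p, q, a, b, ha0, hp, hq, ha, hb, h => by
    have hα0 : 0 < α := by linarith
    rw [searchBox, Bool.or_eq_true, Bool.or_eq_true, Nat.blt_eq, Bool.and_eq_true] at h
    rcases h with (h | ⟨-, h⟩) | h
    · exfalso
      have h' : ((Y * b : ℕ) : ℝ) < (p * αScale : ℕ) := by exact_mod_cast h
      push_cast at *
      have : Y * (α * 655360) ≤ (Y * b : ℝ) := by gcongr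
      linarith
    · obtain ⟨k, rfl⟩ : ∃ k', k = k' + 1 := ⟨k - 1, by omega⟩
      have hfin : ∀ n ≥ k + 1, ∀ A ⊆ Ico 1 n, ∀ L : ℕ, HasRun (term t α) A L →
          c.num b * (t * α ^ n * yScale) ≤ c.den * L → IsCompleteSeq (floorSeq t α) := by
        intro n hn A hA L hrun hL
        refine hc.isCompleteSeq hα1 hb (hY.trans ?_) (by omega) hA hrun hL
        have := hα1.le
        gcongr
      have hx : 0 ≤ t * α ^ k := by positivity
      have hp' : p ≤ t * α ^ k * α * yScale := by rwa [mul_assoc t, ← pow_succ]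
      have hq' : t * α ^ k * α * yScale ≤ q := by rwa [mul_assoc t, ← pow_succ]
      exact isCompleteSeq_of_searchDown ht hα0 ha0 ha hb c.den_pos hfin hT hk hp hq (empty_subset _)
        (Nat.lt_succ_self k) (le_div_of_bounds hα0 hx hp' hb) (div_le_of_bounds hx ha0 hq' ha)
        (marks_one _) h
    · simp only [Bool.cond_eq_ite, Nat.ble_eq] at h
      split_ifs at h
      · rw [Bool.and_eq_true] at h
        rcases le_total (t * α ^ k * yScale) (((p + q) / 2 : ℕ) : ℝ) with hd | hd
        · exact isCompleteSeq_of_searchBox ht hα1 hc hT hk hY hY' ha0 hp hd ha hb h.1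
        · exact isCompleteSeq_of_searchBox ht hα1 hc hT hk hY hY' ha0 hd hq ha hb h.2
      · rw [Bool.and_eq_true] at h
        have hab : a ≤ b := by exact_mod_cast ha.trans hb
        rcases le_total (α * αScale) (((a + b) / 2 : ℕ) : ℝ) with hd | hd
        · exact isCompleteSeq_of_searchBox ht hα1 hc hT hk hY hY' ha0 hp hq ha hd h.1
        · exact isCompleteSeq_of_searchBox ht hα1 hc hT hk hY hY' (by omega) hp hq hd hb h.2

/-- Every `t ≤ Y` has a multiple `t α ^ k` with `k ≥ 1` in the interval `(Y, Y α]`. -/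
theorem exists_mul_pow_mem_Ioc {t α Y : ℝ} (ht : 0 < t) (hα : 1 < α) (htY : t ≤ Y) :
    ∃ k ≥ 1, Y < t * α ^ k ∧ t * α ^ k ≤ Y * α := by
  obtain ⟨n, h1, h2⟩ := exists_nat_pow_near (x := Y / t) ((one_le_div ht).2 htY) hα
  refine ⟨n + 1, by omega, by rwa [div_lt_iff₀' ht] at h2, ?_⟩
  rw [le_div_iff₀' ht] at h1
  rw [pow_succ, ← mul_assoc]
  gcongr

/-- The search succeeds for `Y ≤ y ≤ Y α`, `a ≤ α * αScale ≤ b`. The numbers `g`, `N`, `m`, `r`,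
`w` only influence its extent. -/
abbrev SearchSucceeds (c : Criterion) (T Y g N m r w a b : ℕ) : Prop :=
  searchBox c (T * yScale) (Y * yScale) g N m r w 40 (Y * yScale)
    (Y * yScale * b / αScale + 1) a b

theorem SearchSucceeds.isCompleteSeq {c : Criterion} {T Y g N m r w a b : ℕ}
    (h : SearchSucceeds c T Y g N m r w a b) {t α : ℝ} (ht : 0 < t) (hα1 : 1 < α)
    (hc : c.Valid α (Y * yScale)) (hT : t ≤ T) (hTY : T ≤ Y) (ha0 : 0 < a) (ha : a ≤ α * αScale)
    (hb : α * αScale ≤ b) : IsCompleteSeq (floorSeq t α) := by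
  have hTY' : (T : ℝ) ≤ Y := by exact_mod_cast hTY
  obtain ⟨k, hk, h1, h2⟩ := exists_mul_pow_mem_Ioc ht hα1 (hT.trans hTY')
  refine isCompleteSeq_of_searchBox (k := k) ht hα1 hc ?_ hk ?_ ?_ ha0 ?_ ?_ ha hb h
  · push_cast at *; linarith
  · push_cast at *; linarith
  · push_cast at *; linarith
  · push_cast at *; linarith
  · refine le_trans ?_ (mul_le_of_bounds (x := Y) (by linarith) (by push_cast; rfl) hb)
    gcongr

/-! ### Evaluation of the search

The intervals for `α`, in units of `1 / αScale`, are cut into pieces to keep each evaluation short.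
-/

set_option maxRecDepth 100000

theorem searchSucceeds_851968_896000 : SearchSucceeds .term 3 13 9 11 7 3 4096 851968 896000 := by
  decide +kernel

theorem searchSucceeds_896000_917504 : SearchSucceeds .term 3 13 9 11 7 3 4096 896000 917504 := by
  decide +kernel

theorem searchSucceeds_786432_837120 : SearchSucceeds .term 5 14 7 10 7 3 4096 786432 837120 := by
  decide +kernel

theorem searchSucceeds_837120_851968 : SearchSucceeds .term 5 14 7 10 7 3 4096 837120 851968 := by
  decide +kernel

theorem searchSucceeds_720896_766000 : SearchSucceeds .term 10 20 8 10 7 3 2048 720896 766000 := by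
  decide +kernel

theorem searchSucceeds_766000_786432 : SearchSucceeds .term 10 20 8 10 7 3 2048 766000 786432 := by
  decide +kernel

theorem searchSucceeds_659948_675021 : SearchSucceeds .gap 50 64 8 10 0 2 1024 659948 675021 := by
  decide +kernel

theorem searchSucceeds_675021_694682 : SearchSucceeds .gap 50 80 8 10 0 6 512 675021 694682 := by
  decide +kernel

theorem searchSucceeds_694682_699500 : SearchSucceeds .gap 50 97 9 12 0 6 256 694682 699500 := by
  decide +kernel

theorem searchSucceeds_699500_703700 : SearchSucceeds .gap 50 97 9 12 0 6 256 699500 703700 := by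
  decide +kernel

theorem searchSucceeds_703700_707789 : SearchSucceeds .gap 50 97 9 12 0 6 256 703700 707789 := by
  decide +kernel

theorem searchSucceeds_707789_710100 : SearchSucceeds .gap 50 107 7 10 0 4 256 707789 710100 := by
  decide +kernel

theorem searchSucceeds_710100_712100 : SearchSucceeds .gap 50 107 7 10 0 4 256 710100 712100 := by
  decide +kernel

theorem searchSucceeds_712100_714150 : SearchSucceeds .gap 50 107 7 10 0 4 256 712100 714150 := by
  decide +kernel

theorem searchSucceeds_714150_715900 : SearchSucceeds .gap 50 107 7 10 0 4 256 714150 715900 := by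
  decide +kernel

theorem searchSucceeds_715900_717650 : SearchSucceeds .gap 50 107 7 10 0 4 256 715900 717650 := by
  decide +kernel

theorem searchSucceeds_717650_719100 : SearchSucceeds .gap 50 107 7 10 0 4 256 717650 719100 := by
  decide +kernel

theorem searchSucceeds_719100_720896 : SearchSucceeds .gap 50 107 7 10 0 4 256 719100 720896 := by
  decide +kernel

/-! ### The parameter ranges -/

/-- For `α` up to about `1.007` no search is needed: the sum over the empty set is a run of length
`1`, and `2.6 * (α - 1) * x < 1` for the first `x = t α ^ k` above `50`. -/
theorem isCompleteSeq_of_le_50_of_small {t α : ℝ} (ht : 0 < t) (hα1 : 1 < α) (hT : t ≤ 50)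
    (hα : α * αScale ≤ 659948) : IsCompleteSeq (floorSeq t α) := by
  obtain ⟨k, hk, h1, h2⟩ := exists_mul_pow_mem_Ioc ht hα1 hT
  push_cast at hα
  refine isCompleteSeq_of_hasRun_of_gap_le (n := k) (L := 1) (A := ∅) (by simp) hk hα1
    (by linarith) h1.le ⟨0, by simp⟩ ?_
  push_cast
  nlinarith

theorem isCompleteSeq_of_le_3 {t α : ℝ} (ht : 0 < t) (hα1 : 1.3 < α) (hα : α ≤ 1.4)
    (hT : t ≤ 3) : IsCompleteSeq (floorSeq t α) := by
  rcases le_total (α * αScale) (896000 : ℕ) with h1 | h1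
  · exact searchSucceeds_851968_896000.isCompleteSeq ht (by linarith) ⟨by linarith, by norm_num⟩
      (by simpa using hT) (by norm_num) (by norm_num) (by push_cast; linarith) h1
  exact searchSucceeds_896000_917504.isCompleteSeq ht (by linarith) ⟨by linarith, by norm_num⟩
    (by simpa using hT) (by norm_num) (by norm_num) h1 (by push_cast; linarith)

theorem isCompleteSeq_of_le_5 {t α : ℝ} (ht : 0 < t) (hα1 : 1.2 < α) (hα : α ≤ 1.3)
    (hT : t ≤ 5) : IsCompleteSeq (floorSeq t α) := by
  rcases le_total (α * αScale) (837120 : ℕ) with h1 | h1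
  · exact searchSucceeds_786432_837120.isCompleteSeq ht (by linarith) ⟨by linarith, by norm_num⟩
      (by simpa using hT) (by norm_num) (by norm_num) (by push_cast; linarith) h1
  exact searchSucceeds_837120_851968.isCompleteSeq ht (by linarith) ⟨by linarith, by norm_num⟩
    (by simpa using hT) (by norm_num) (by norm_num) h1 (by push_cast; linarith)

theorem isCompleteSeq_of_le_10 {t α : ℝ} (ht : 0 < t) (hα1 : 1.1 < α) (hα : α ≤ 1.2)
    (hT : t ≤ 10) : IsCompleteSeq (floorSeq t α) := by
  rcases le_total (α * αScale) (766000 : ℕ) with h1 | h1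
  · exact searchSucceeds_720896_766000.isCompleteSeq ht (by linarith) ⟨by linarith, by norm_num⟩
      (by simpa using hT) (by norm_num) (by norm_num) (by push_cast; linarith) h1
  exact searchSucceeds_766000_786432.isCompleteSeq ht (by linarith) ⟨by linarith, by norm_num⟩
    (by simpa using hT) (by norm_num) (by norm_num) h1 (by push_cast; linarith)

theorem isCompleteSeq_of_le_50 {t α : ℝ} (ht : 0 < t) (hα1 : 1 < α) (hα : α ≤ 1.1)
    (hT : t ≤ 50) : IsCompleteSeq (floorSeq t α) := by
  rcases le_total (α * αScale) (659948 : ℕ) with h0 | h0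
  · exact isCompleteSeq_of_le_50_of_small ht hα1 hT (by exact_mod_cast h0)
  rcases le_total (α * αScale) (675021 : ℕ) with h1 | h1
  · exact searchSucceeds_659948_675021.isCompleteSeq ht hα1 ⟨by linarith, by norm_num⟩
      (by simpa using hT) (by norm_num) (by norm_num) h0 h1
  rcases le_total (α * αScale) (694682 : ℕ) with h2 | h2
  · exact searchSucceeds_675021_694682.isCompleteSeq ht hα1 ⟨by linarith, by norm_num⟩
      (by simpa using hT) (by norm_num) (by norm_num) h1 h2
  rcases le_total (α * αScale) (699500 : ℕ) with h3 | h3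
  · exact searchSucceeds_694682_699500.isCompleteSeq ht hα1 ⟨by linarith, by norm_num⟩
      (by simpa using hT) (by norm_num) (by norm_num) h2 h3
  rcases le_total (α * αScale) (703700 : ℕ) with h4 | h4
  · exact searchSucceeds_699500_703700.isCompleteSeq ht hα1 ⟨by linarith, by norm_num⟩
      (by simpa using hT) (by norm_num) (by norm_num) h3 h4
  rcases le_total (α * αScale) (707789 : ℕ) with h5 | h5
  · exact searchSucceeds_703700_707789.isCompleteSeq ht hα1 ⟨by linarith, by norm_num⟩
      (by simpa using hT) (by norm_num) (by norm_num) h4 h5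
  rcases le_total (α * αScale) (710100 : ℕ) with h6 | h6
  · exact searchSucceeds_707789_710100.isCompleteSeq ht hα1 ⟨by linarith, by norm_num⟩
      (by simpa using hT) (by norm_num) (by norm_num) h5 h6
  rcases le_total (α * αScale) (712100 : ℕ) with h7 | h7
  · exact searchSucceeds_710100_712100.isCompleteSeq ht hα1 ⟨by linarith, by norm_num⟩
      (by simpa using hT) (by norm_num) (by norm_num) h6 h7
  rcases le_total (α * αScale) (714150 : ℕ) with h8 | h8
  · exact searchSucceeds_712100_714150.isCompleteSeq ht hα1 ⟨by linarith, by norm_num⟩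
      (by simpa using hT) (by norm_num) (by norm_num) h7 h8
  rcases le_total (α * αScale) (715900 : ℕ) with h9 | h9
  · exact searchSucceeds_714150_715900.isCompleteSeq ht hα1 ⟨by linarith, by norm_num⟩
      (by simpa using hT) (by norm_num) (by norm_num) h8 h9
  rcases le_total (α * αScale) (717650 : ℕ) with h10 | h10
  · exact searchSucceeds_715900_717650.isCompleteSeq ht hα1 ⟨by linarith, by norm_num⟩
      (by simpa using hT) (by norm_num) (by norm_num) h9 h10
  rcases le_total (α * αScale) (719100 : ℕ) with h11 | h11
  · exact searchSucceeds_717650_719100.isCompleteSeq ht hα1 ⟨by linarith, by norm_num⟩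
      (by simpa using hT) (by norm_num) (by norm_num) h10 h11
  exact searchSucceeds_719100_720896.isCompleteSeq ht hα1 ⟨by linarith, by norm_num⟩
    (by simpa using hT) (by norm_num) (by norm_num) h11 (by push_cast; linarith)

end FloorSeq

theorem mainTheorem9 (t α : ℝ) (ht : 0 < t) :
    (1.3 < α → α ≤ 1.4 → t ≤ 3 → IsCompleteSeq (floorSeq t α)) ∧
    (1.2 < α → α ≤ 1.3 → t ≤ 5 → IsCompleteSeq (floorSeq t α)) ∧
    (1.1 < α → α ≤ 1.2 → t ≤ 10 → IsCompleteSeq (floorSeq t α)) ∧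
    (1 < α → α ≤ 1.1 → t ≤ 50 → IsCompleteSeq (floorSeq t α)) :=
  ⟨FloorSeq.isCompleteSeq_of_le_3 ht, FloorSeq.isCompleteSeq_of_le_5 ht,
    FloorSeq.isCompleteSeq_of_le_10 ht, FloorSeq.isCompleteSeq_of_le_50 ht⟩
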